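/- Let $E=(E^0,E^1,r,s)$ be a directed graph (of arbitrary cardinality, loops and multiple edges allowed) that is row-finite, i.e. every vertex emits only finitely many edges, and let $R$ be a nonzero commutative ring with unit. Let $L_R(E)$ be the Leavitt path algebra, i.e. the universal (not necessarily unital) associative $R$-algebra generated by elements $v\in E^0$ and $e,e^*$ ($e\in E^1$) subject to: the $v$ are pairwise orthogonal idempotents; $s(e)e=e\,r(e)=e$ and $e^*s(e)=r(e)e^*=e^*$; $e^*f=\delta_{e,f}\,r(e)$; and $v=\sum_{s(e)=v}ee^*$ for every vertex $v$ that emits at least one and at most finitely many edges. Its canonical $\mathbb Z$-grading has as component $L_R(E)_m$ the $R$-span of all $\alpha\beta^*$ with $\alpha,\beta$ finite paths (vertices being the paths of length $0$), $r(\alpha)=r(\beta)$ and $|\alpha|-|\beta|=m$; for an integer $n\ge 1$ its $\mathbb Z/n\mathbb Z$-grading is the quotient grading, with components $\bigoplus_{m\in k+n\mathbb Z}L_R(E)_m$. A ring $A$ with a family of additive subgroups $(A_\gamma)_{\gamma\in\Gamma}$ indexed by an additive group $\Gamma$ is strongly $\Gamma$-graded if $A=\bigoplus_\gamma A_\gamma$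 and $A_\gamma A_\delta=A_{\gamma+\delta}$ for all $\gamma,\delta\in\Gamma$, where $A_\gamma A_\delta$ denotes the set of finite sums of products $ab$ with $a\in A_\gamma$, $b\in A_\delta$. A vertex is a sink if it emits no edge, and isolated if it neither emits nor receives an edge. Then: 1. $L_R(E)$ is strongly $\mathbb Z/2\mathbb Z$-graded if and only if $E$ has no isolated vertex. 2. If $E$ has no sink, then $L_R(E)$ is strongly $\mathbb Z/n\mathbb Z$-graded for every integer $n\ge 1$. 3. If $E^0$ is finite, then $L_R(E)$ is strongly $\mathbb Z$-graded if and only if $E$ has no sink. -/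

import Mathlib

universe u v w

/-- A directed graph with vertex set `V` and edge set `E`, given by its source and range maps.
Loops and multiple edges are allowed, and there is no restriction on cardinalities. -/
structure DirGraph (V : Type u) (E : Type v) where
  /-- the source map -/
  src : E → V
  /-- the range map -/
  rng : E → V

namespace DirGraph

/-- A sink is a vertex that emits no edges. -/
def IsSink {V : Type u} {E : Type v} (G : DirGraph V E) (x : V) : Prop :=
  ∀ e : E, G.src e ≠ x

/-- A graph is row-finite if no vertex emits infinitely many edges. -/
def RowFinite {V : Type u} {E : Type v} (G : DirGraph V E) : Prop :=
  ∀ x : V, {e : E | G.src e = x}.Finite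

/-- An isolated vertex neither receives nor emits any edges. -/
def IsIsolated {V : Type u} {E : Type v} (G : DirGraph V E) (x : V) : Prop :=
  ∀ e : E, G.src e ≠ x ∧ G.rng e ≠ x

/-- `G.IsPath x α y` says that the list of edges `α` is a finite path that starts at `x` and ends
at `y`; the empty list is the path of length zero at `x = y`. -/
def IsPath {V : Type u} {E : Type v} (G : DirGraph V E) : V → List E → V → Prop
  | x, [], y => x = y
  | x, e :: α, y => G.src e = x ∧ G.IsPath (G.rng e) α y

end DirGraph

/-- The symbols `x`, `e`, `e*` (for vertices `x` and edges `e`) that generate a Leavitt path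
algebra. -/
inductive LeavittGen (V : Type u) (E : Type v) : Type (max u v)
  | vert : V → LeavittGen V E
  | edge : E → LeavittGen V E
  | ghost : E → LeavittGen V E

noncomputable section

/-- The free associative (not necessarily unital) `R`-algebra on the set `X`: the semigroup algebra
of the free semigroup of nonempty words in `X`. -/
abbrev FreeAssocAlg (R : Type w) [CommRing R] (X : Type u) : Type (max u w) :=
  MonoidAlgebra R (FreeSemigroup X)

/-- A generator, as an element of the free associative algebra. -/
def FreeAssocAlg.gen (R : Type w) [CommRing R] {X : Type u} (x : X) : FreeAssocAlg R X :=
  MonoidAlgebra.single (FreeSemigroup.of x) 1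

open FreeAssocAlg LeavittGen in
/-- The defining relations of a Leavitt family of the graph `G`. -/
inductive LeavittRel (R : Type w) [CommRing R] {V : Type u} {E : Type v} (G : DirGraph V E) :
    FreeAssocAlg R (LeavittGen V E) → FreeAssocAlg R (LeavittGen V E) → Prop
  | vert_idem (x : V) : LeavittRel R G (gen R (vert x) * gen R (vert x)) (gen R (vert x))
  | vert_orth (x y : V) (h : x ≠ y) : LeavittRel R G (gen R (vert x) * gen R (vert y)) 0
  | src_edge (e : E) : LeavittRel R G (gen R (vert (G.src e)) * gen R (edge e)) (gen R (edge e))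
  | edge_rng (e : E) : LeavittRel R G (gen R (edge e) * gen R (vert (G.rng e))) (gen R (edge e))
  | ghost_src (e : E) :
      LeavittRel R G (gen R (ghost e) * gen R (vert (G.src e))) (gen R (ghost e))
  | rng_ghost (e : E) :
      LeavittRel R G (gen R (vert (G.rng e)) * gen R (ghost e)) (gen R (ghost e))
  | ghost_edge (e : E) :
      LeavittRel R G (gen R (ghost e) * gen R (edge e)) (gen R (vert (G.rng e)))
  | ghost_edge_ne (e f : E) (h : e ≠ f) : LeavittRel R G (gen R (ghost e) * gen R (edge f)) 0
  /-- The relation at a regular vertex, one that emits at least one and finitely many edges. -/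
  | vert_sum (x : V) (hne : {e : E | G.src e = x}.Nonempty) (hfin : {e : E | G.src e = x}.Finite) :
      LeavittRel R G (gen R (vert x)) (∑ e ∈ hfin.toFinset, gen R (edge e) * gen R (ghost e))

/-- The set of `R`-multiples of the defining relations. (In an algebra without unit, the ring
congruence generated by a set of relations need not be stable under scalars.) -/
def LeavittScalarRel (R : Type w) [CommRing R] {V : Type u} {E : Type v} (G : DirGraph V E)
    (a b : FreeAssocAlg R (LeavittGen V E)) : Prop :=
  ∃ (c : R) (a₀ b₀ : FreeAssocAlg R (LeavittGen V E)),
    LeavittRel R G a₀ b₀ ∧ a = c • a₀ ∧ b = c • b₀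

/-- The algebra congruence generated by the defining relations. -/
def leavittCon (R : Type w) [CommRing R] {V : Type u} {E : Type v} (G : DirGraph V E) :
    RingCon (FreeAssocAlg R (LeavittGen V E)) :=
  ringConGen (LeavittScalarRel R G)

theorem leavittCon_smul (R : Type w) [CommRing R] {V : Type u} {E : Type v} (G : DirGraph V E)
    (c : R) {a b : FreeAssocAlg R (LeavittGen V E)} (h : leavittCon R G a b) :
    leavittCon R G (c • a) (c • b) := by
  change RingConGen.Rel _ _ _ at h
  change RingConGen.Rel _ _ _
  induction h with
  | of a b h =>
    obtain ⟨d, a₀, b₀, h₀, rfl, rfl⟩ := h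
    exact RingConGen.Rel.of _ _ ⟨c * d, a₀, b₀, h₀, by rw [mul_smul], by rw [mul_smul]⟩
  | refl a => exact RingConGen.Rel.refl _
  | symm _ ih => exact RingConGen.Rel.symm ih
  | trans _ _ ih₁ ih₂ => exact RingConGen.Rel.trans ih₁ ih₂
  | add _ _ ih₁ ih₂ =>
    rw [smul_add, smul_add]
    exact RingConGen.Rel.add ih₁ ih₂
  | mul _ h₂ ih₁ _ =>
    rw [← smul_mul_assoc, ← smul_mul_assoc]
    exact RingConGen.Rel.mul ih₁ h₂

/-- The Leavitt path algebra `L_R(G)`: the universal (not necessarily unital) associative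
`R`-algebra generated by a Leavitt family of the graph `G`. -/
def LeavittPathAlgebra (R : Type w) [CommRing R] {V : Type u} {E : Type v} (G : DirGraph V E) :
    Type (max u v w) :=
  (leavittCon R G).Quotient

namespace LeavittPathAlgebra

instance instNonUnitalRing (R : Type w) [CommRing R] {V : Type u} {E : Type v}
    (G : DirGraph V E) : NonUnitalRing (LeavittPathAlgebra R G) :=
  inferInstanceAs (NonUnitalRing (leavittCon R G).Quotient)

/-- The quotient map from the free algebra. -/
def mk (R : Type w) [CommRing R] {V : Type u} {E : Type v} (G : DirGraph V E) :
    FreeAssocAlg R (LeavittGen V E) →ₙ+* LeavittPathAlgebra R G where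
  toFun a := RingCon.toQuotient (c := leavittCon R G) a
  map_mul' _ _ := rfl
  map_zero' := rfl
  map_add' _ _ := rfl

theorem mk_surjective (R : Type w) [CommRing R] {V : Type u} {E : Type v} (G : DirGraph V E) :
    Function.Surjective (mk R G) :=
  Quotient.mk''_surjective

instance instSMul (R : Type w) [CommRing R] {V : Type u} {E : Type v}
    (G : DirGraph V E) : SMul R (LeavittPathAlgebra R G) where
  smul c := Quotient.map' (c • ·) fun _ _ h => leavittCon_smul R G c h

theorem mk_smul (R : Type w) [CommRing R] {V : Type u} {E : Type v} (G : DirGraph V E) (c : R)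
    (a : FreeAssocAlg R (LeavittGen V E)) : mk R G (c • a) = c • mk R G a :=
  rfl

instance instModule (R : Type w) [CommRing R] {V : Type u} {E : Type v}
    (G : DirGraph V E) : Module R (LeavittPathAlgebra R G) :=
  Function.Surjective.module R (mk R G).toAddMonoidHom (mk_surjective R G) (mk_smul R G)

instance instIsScalarTower (R : Type w) [CommRing R] {V : Type u} {E : Type v}
    (G : DirGraph V E) :
    IsScalarTower R (LeavittPathAlgebra R G) (LeavittPathAlgebra R G) where
  smul_assoc c a b := by
    obtain ⟨a, rfl⟩ := mk_surjective R G a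
    obtain ⟨b, rfl⟩ := mk_surjective R G b
    simp only [smul_eq_mul, ← mk_smul, ← map_mul, smul_mul_assoc]

instance instSMulCommClass (R : Type w) [CommRing R] {V : Type u} {E : Type v}
    (G : DirGraph V E) :
    SMulCommClass R (LeavittPathAlgebra R G) (LeavittPathAlgebra R G) where
  smul_comm c a b := by
    obtain ⟨a, rfl⟩ := mk_surjective R G a
    obtain ⟨b, rfl⟩ := mk_surjective R G b
    simp only [smul_eq_mul, ← mk_smul, ← map_mul, mul_smul_comm]

/-- The element `x` of `L_R(G)`, for a vertex `x`. -/
def vert (R : Type w) [CommRing R] {V : Type u} {E : Type v} (G : DirGraph V E) (x : V) :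
    LeavittPathAlgebra R G :=
  mk R G (FreeAssocAlg.gen R (LeavittGen.vert x))

/-- The element `e` of `L_R(G)`, for an edge `e`. -/
def edge (R : Type w) [CommRing R] {V : Type u} {E : Type v} (G : DirGraph V E) (e : E) :
    LeavittPathAlgebra R G :=
  mk R G (FreeAssocAlg.gen R (LeavittGen.edge e))

/-- The element `e*` of `L_R(G)`, for an edge `e`. -/
def ghost (R : Type w) [CommRing R] {V : Type u} {E : Type v} (G : DirGraph V E) (e : E) :
    LeavittPathAlgebra R G :=
  mk R G (FreeAssocAlg.gen R (LeavittGen.ghost e))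

/-- The element `α` of `L_R(G)`, for a path `α` starting at `x`: the vertex `x` itself if `α` has
length zero, and `α = α₁ ⋯ αₙ` otherwise (the range of `αₙ` is absorbed on the right). -/
def path (R : Type w) [CommRing R] {V : Type u} {E : Type v} (G : DirGraph V E) :
    V → List E → LeavittPathAlgebra R G
  | x, [] => vert R G x
  | _, e :: α => edge R G e * path R G (G.rng e) α

/-- The element `α*` of `L_R(G)`, for a path `α` starting at `x`: the vertex `x` itself if `α` has
length zero, and `α* = αₙ* ⋯ α₁*` otherwise. -/
def ghostPath (R : Type w) [CommRing R] {V : Type u} {E : Type v} (G : DirGraph V E) :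
    V → List E → LeavittPathAlgebra R G
  | x, [] => vert R G x
  | _, e :: α => ghostPath R G (G.rng e) α * ghost R G e

/-- The homogeneous component of degree `n` of `L_R(G)` in the canonical `ℤ`-grading: the `R`-span
of the elements `α β*`, where `α` and `β` are finite paths with the same range and
`|α| - |β| = n`. -/
def component (R : Type w) [CommRing R] {V : Type u} {E : Type v} (G : DirGraph V E) (n : ℤ) :
    Submodule R (LeavittPathAlgebra R G) :=
  Submodule.span R {a | ∃ (x y z : V) (α β : List E), G.IsPath x α z ∧ G.IsPath y β z ∧
    (α.length : ℤ) - (β.length : ℤ) = n ∧ a = path R G x α * ghostPath R G y β}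

/-- The canonical `ℤ`-grading of `L_R(G)`, as a family of additive subgroups. -/
def grading (R : Type w) [CommRing R] {V : Type u} {E : Type v} (G : DirGraph V E) (n : ℤ) :
    AddSubgroup (LeavittPathAlgebra R G) :=
  (component R G n).toAddSubgroup

/-- The quotient `ℤ/nℤ`-grading of `L_R(G)`: the component of degree `k` is the sum of the
components of the canonical grading whose degree lies in the coset `k` of `nℤ`. -/
def modGrading (R : Type w) [CommRing R] {V : Type u} {E : Type v} (G : DirGraph V E) (n : ℕ)
    (k : ZMod n) : AddSubgroup (LeavittPathAlgebra R G) :=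
  ⨆ (m : ℤ) (_ : (m : ZMod n) = k), grading R G m

end LeavittPathAlgebra

/-- A family `𝒜` of additive subgroups of a (not necessarily unital) ring `A`, indexed by an
additively written group `Γ`, makes `A` a strongly `Γ`-graded ring if `A` is the direct sum of the
`𝒜 γ` and `𝒜 γ * 𝒜 δ = 𝒜 (γ + δ)` for all `γ` and `δ`, where `𝒜 γ * 𝒜 δ` is the additive subgroup
generated by the products of an element of `𝒜 γ` and an element of `𝒜 δ`. -/
structure IsStronglyGraded {Γ : Type u} [AddGroup Γ] [DecidableEq Γ] {A : Type v} [NonUnitalRing A]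
    (𝒜 : Γ → AddSubgroup A) : Prop where
  isInternal : DirectSum.IsInternal 𝒜
  mul_eq : ∀ γ δ : Γ,
    AddSubgroup.closure {c : A | ∃ a ∈ 𝒜 γ, ∃ b ∈ 𝒜 δ, c = a * b} = 𝒜 (γ + δ)

end

/-!
Everything is done for the grading of `L_R(G)` obtained by pushing the canonical `ℤ`-grading forward
along an arbitrary homomorphism `d : ℤ →+ Γ`; the gradings by `ℤ` and by `ℤ/nℤ` are special cases.

*Grading.* By the universal property, `x ↦ x t⁰`, `e ↦ e t^{d 1}`, `e* ↦ e* t^{-d 1}` extends to a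
homomorphism `degreeHom` from `L_R(G)` to the group algebra of `Γ` over the unitization of `L_R(G)`.
It sends `a` to `a t^γ` when `a` has degree `γ`, and the monomials `α β*` span `L_R(G)`; so the
components are independent, the component of degree `γ` consists of exactly those `a` with
`a ↦ a t^γ`, and the product of components of degrees `γ` and `δ` lies in degree `γ + δ`.

*Strong grading.* Every monomial `α β*` is fixed by left multiplication by the source of `α`, so it
is enough to write each vertex `x` as a sum of products of degrees `γ` and `-γ`. If no path of
length less than `N` leads from `x` to a sink, then the relations at regular vertices give
`x = ∑ α α*` over the paths `α` of length `N` starting at `x`. If `β` is a path with the same range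
as `α` and `d (|α| - |β|) = γ`, then `α α* = (α β*) (β α*)` is a product of the required kind
(`isStronglyGraded_of_paths`). For `ℤ/nℤ` and no sinks one takes `β` of length zero. For `ℤ/2ℤ`, a
sink that is not isolated is the range of some edge `β = e`, and `N = 0` works. For `ℤ` and finitely
many vertices, the set of ends of paths of length `k` decreases with `k`, so it is eventually
constant, and for large `N` there is a `β` of each length close to `N`.

*Necessity.* If `x` is a sink and no path ending at `x` has length `k` with `d (-k) = γ`, then `x`
annihilates the component of degree `γ`, so a strong grading would give `x = x x = 0`
(`not_isStronglyGraded_of_isSink`). But a sink `x` is nonzero, because `L_R(G)` acts on functions on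
the set of paths that end at `x`.
-/

universe u₁

noncomputable section

namespace DirGraph

variable {V : Type u} {E : Type v} {G : DirGraph V E}

theorem IsPath.append_edge {x : V} {α : List E} {e : E} (h : G.IsPath x α (G.src e)) :
    G.IsPath x (α ++ [e]) (G.rng e) := by
  induction α generalizing x with
  | nil => exact ⟨Eq.symm h, rfl⟩
  | cons f α ih => exact ⟨h.1, ih h.2⟩

theorem IsPath.start_unique {x y z : V} {α : List E} (hx : G.IsPath x α z) (hy : G.IsPath y α z) :
    x = y := by
  cases α with
  | nil => exact Eq.trans hx (Eq.symm hy)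
  | cons e α => exact hx.1.symm.trans hy.1

theorem IsPath.eq_nil_of_isSink {x z : V} {α : List E} (h : G.IsPath x α z) (hx : G.IsSink x) :
    α = [] := by
  cases α with
  | nil => rfl
  | cons e α => exact absurd h.1 (hx e)

theorem IsPath.eq_nil_of_isIsolated {x z : V} {α : List E} (h : G.IsPath x α z)
    (hz : G.IsIsolated z) : α = [] := by
  induction α generalizing x with
  | nil => rfl
  | cons e α ih =>
    obtain rfl := ih h.2
    exact absurd h.2 (hz e).2

/-- The set of ends of the paths of length `k`. -/
def pathEnds (G : DirGraph V E) (k : ℕ) : Set V :=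
  {z | ∃ (y : V) (β : List E), G.IsPath y β z ∧ β.length = k}

theorem pathEnds_antitone (G : DirGraph V E) : Antitone G.pathEnds := by
  refine antitone_nat_of_succ_le fun k z hz => ?_
  obtain ⟨y, β, hβ, hk⟩ := hz
  cases β with
  | nil => simp at hk
  | cons e β => exact ⟨_, β, hβ.2, by simpa using hk⟩

end DirGraph

namespace LeavittPathAlgebra

variable {R : Type w} [CommRing R] {V : Type u} {E : Type v} {G : DirGraph V E}

/-! ### Relations between paths and ghost paths -/

theorem mk_eq_of_rel {a b : FreeAssocAlg R (LeavittGen V E)} (h : LeavittRel R G a b) :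
    mk R G a = mk R G b :=
  Quotient.sound' (RingConGen.Rel.of _ _ ⟨1, a, b, h, (one_smul _ _).symm, (one_smul _ _).symm⟩)

theorem vert_mul_self (x : V) : vert R G x * vert R G x = vert R G x := by
  simpa [vert] using mk_eq_of_rel (LeavittRel.vert_idem (R := R) (G := G) x)

theorem vert_mul_vert_of_ne {x y : V} (h : x ≠ y) : vert R G x * vert R G y = 0 := by
  simpa [vert] using mk_eq_of_rel (LeavittRel.vert_orth (R := R) (G := G) x y h)

theorem vert_mul_edge (e : E) : vert R G (G.src e) * edge R G e = edge R G e := by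
  simpa [vert, edge] using mk_eq_of_rel (LeavittRel.src_edge (R := R) (G := G) e)

theorem edge_mul_vert (e : E) : edge R G e * vert R G (G.rng e) = edge R G e := by
  simpa [vert, edge] using mk_eq_of_rel (LeavittRel.edge_rng (R := R) (G := G) e)

theorem ghost_mul_vert (e : E) : ghost R G e * vert R G (G.src e) = ghost R G e := by
  simpa [vert, ghost] using mk_eq_of_rel (LeavittRel.ghost_src (R := R) (G := G) e)

theorem vert_mul_ghost (e : E) : vert R G (G.rng e) * ghost R G e = ghost R G e := by
  simpa [vert, ghost] using mk_eq_of_rel (LeavittRel.rng_ghost (R := R) (G := G) e)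

theorem ghost_mul_edge (e : E) : ghost R G e * edge R G e = vert R G (G.rng e) := by
  simpa [vert, edge, ghost] using mk_eq_of_rel (LeavittRel.ghost_edge (R := R) (G := G) e)

theorem ghost_mul_edge_of_ne {e f : E} (h : e ≠ f) : ghost R G e * edge R G f = 0 := by
  simpa [edge, ghost] using mk_eq_of_rel (LeavittRel.ghost_edge_ne (R := R) (G := G) e f h)

theorem vert_eq_sum (x : V) (hne : {e : E | G.src e = x}.Nonempty)
    (hfin : {e : E | G.src e = x}.Finite) :
    vert R G x = ∑ e ∈ hfin.toFinset, edge R G e * ghost R G e := by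
  simpa [vert, edge, ghost] using mk_eq_of_rel (LeavittRel.vert_sum (R := R) (G := G) x hne hfin)

theorem vert_mul_path {x z : V} {α : List E} (h : G.IsPath x α z) :
    vert R G x * path R G x α = path R G x α := by
  cases α with
  | nil => exact vert_mul_self x
  | cons e α => rw [path, ← mul_assoc, ← h.1, vert_mul_edge]

theorem path_mul_vert {x z : V} {α : List E} (h : G.IsPath x α z) :
    path R G x α * vert R G z = path R G x α := by
  induction α generalizing x with
  | nil => obtain rfl : x = z := h; exact vert_mul_self x
  | cons e α ih => rw [path, mul_assoc, ih h.2]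

theorem vert_mul_ghostPath {x z : V} {α : List E} (h : G.IsPath x α z) :
    vert R G z * ghostPath R G x α = ghostPath R G x α := by
  induction α generalizing x with
  | nil => obtain rfl : x = z := h; exact vert_mul_self x
  | cons e α ih => rw [ghostPath, ← mul_assoc, ih h.2]

theorem ghostPath_mul_vert {x z : V} {α : List E} (h : G.IsPath x α z) :
    ghostPath R G x α * vert R G x = ghostPath R G x α := by
  cases α with
  | nil => exact vert_mul_self x
  | cons e α => rw [ghostPath, mul_assoc, ← h.1, ghost_mul_vert]

theorem ghostPath_mul_path {x z : V} {α : List E} (h : G.IsPath x α z) :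
    ghostPath R G x α * path R G x α = vert R G z := by
  induction α generalizing x with
  | nil => obtain rfl : x = z := h; exact vert_mul_self x
  | cons e α ih =>
    rw [ghostPath, path, mul_assoc, ← mul_assoc (ghost R G e), ghost_mul_edge,
      vert_mul_path h.2, ih h.2]

theorem path_append_edge {x : V} {α : List E} {e : E} (h : G.IsPath x α (G.src e)) :
    path R G x (α ++ [e]) = path R G x α * edge R G e := by
  induction α generalizing x with
  | nil =>
    obtain rfl : x = G.src e := h
    simp only [List.nil_append, path, edge_mul_vert, vert_mul_edge]
  | cons f α ih => rw [List.cons_append, path, path, ih h.2, mul_assoc]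

/-! ### The universal property -/

section Lift

variable {A : Type u₁} [NonUnitalRing A] [Module R A] [IsScalarTower R A A] [SMulCommClass R A A]

/-- The homomorphism from the free associative algebra that extends a map on the generators. -/
def freeLift (R : Type w) [CommRing R] {A : Type u₁} [NonUnitalRing A] [Module R A]
    [IsScalarTower R A A] [SMulCommClass R A A] (f : LeavittGen V E → A) :
    FreeAssocAlg R (LeavittGen V E) →ₙₐ[R] A :=
  MonoidAlgebra.liftMagma R (FreeSemigroup.lift f)

@[simp]
theorem freeLift_gen (f : LeavittGen V E → A) (x : LeavittGen V E) :
    freeLift R f (FreeAssocAlg.gen R x) = f x := by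
  simp [freeLift, FreeAssocAlg.gen]

theorem freeLift_eq_of_con (f : LeavittGen V E → A)
    (hf : ∀ a b, LeavittRel R G a b → freeLift R f a = freeLift R f b)
    {a b : FreeAssocAlg R (LeavittGen V E)} (h : leavittCon R G a b) :
    freeLift R f a = freeLift R f b := by
  change RingConGen.Rel _ _ _ at h
  induction h with
  | of a b h =>
    obtain ⟨c, a₀, b₀, h₀, rfl, rfl⟩ := h
    rw [map_smul, map_smul, hf _ _ h₀]
  | refl a => rfl
  | symm _ ih => exact ih.symm
  | trans _ _ ih₁ ih₂ => exact ih₁.trans ih₂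
  | add _ _ ih₁ ih₂ => rw [map_add, map_add, ih₁, ih₂]
  | mul _ _ ih₁ ih₂ => rw [map_mul, map_mul, ih₁, ih₂]

/-- The universal property of `L_R(G)`: a map on the generators that respects the defining
relations extends to a homomorphism of `R`-algebras. -/
def lift (f : LeavittGen V E → A)
    (hf : ∀ a b, LeavittRel R G a b → freeLift R f a = freeLift R f b) :
    LeavittPathAlgebra R G →ₙₐ[R] A where
  toFun := fun a => Quotient.liftOn' a (freeLift R f) fun _ _ h => freeLift_eq_of_con f hf h
  map_smul' c a := by
    obtain ⟨a, rfl⟩ := mk_surjective R G a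
    exact map_smul (freeLift R f) c a
  map_zero' := map_zero (freeLift R f)
  map_add' a b := by
    obtain ⟨a, rfl⟩ := mk_surjective R G a
    obtain ⟨b, rfl⟩ := mk_surjective R G b
    exact map_add (freeLift R f) a b
  map_mul' a b := by
    obtain ⟨a, rfl⟩ := mk_surjective R G a
    obtain ⟨b, rfl⟩ := mk_surjective R G b
    exact map_mul (freeLift R f) a b

variable (f : LeavittGen V E → A)
  (hf : ∀ a b, LeavittRel R G a b → freeLift R f a = freeLift R f b)

@[simp]
theorem lift_vert (x : V) : lift f hf (vert R G x) = f (.vert x) :=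
  freeLift_gen f _

@[simp]
theorem lift_edge (e : E) : lift f hf (edge R G e) = f (.edge e) :=
  freeLift_gen f _

@[simp]
theorem lift_ghost (e : E) : lift f hf (ghost R G e) = f (.ghost e) :=
  freeLift_gen f _

end Lift

/-! ### Sinks are nonzero -/

section Representation

open Classical in
/-- The action of the generators on functions on the set of lists of edges, where only the values
at paths ending at `x₀` matter. A vertex restricts a function to the paths that start there; on
indicator functions of single paths, an edge `e` acts by `α ↦ eα`, and `e*` by `eα ↦ α`. -/
def sinkRep (R : Type w) [CommRing R] {V : Type u} {E : Type v} (G : DirGraph V E) (x₀ : V) :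
    LeavittGen V E → Module.End R (List E → R)
  | .vert x =>
    { toFun := fun f α => if G.IsPath x α x₀ then f α else 0
      map_add' := fun f g => by ext α; simp only [Pi.add_apply]; split_ifs <;> simp
      map_smul' := fun c f => by ext α; simp }
  | .edge e =>
    { toFun := fun f α => match α with
        | [] => 0
        | e' :: β => if e' = e ∧ G.IsPath (G.rng e) β x₀ then f β else 0
      map_add' := fun f g => by
        ext α
        cases α <;> simp only [Pi.add_apply, add_zero]
        split_ifs <;> simp
      map_smul' := fun c f => by ext α; cases α <;> simp }
  | .ghost e =>
    { toFun := fun f α => if G.IsPath (G.rng e) α x₀ then f (e :: α) else 0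
      map_add' := fun f g => by ext α; simp only [Pi.add_apply]; split_ifs <;> simp
      map_smul' := fun c f => by ext α; simp }

variable (x₀ : V) (f : List E → R)

open Classical in
theorem sinkRep_vert_apply (x : V) (α : List E) :
    sinkRep R G x₀ (.vert x) f α = if G.IsPath x α x₀ then f α else 0 := rfl

theorem sinkRep_edge_nil (e : E) : sinkRep R G x₀ (.edge e) f [] = 0 := rfl

open Classical in
theorem sinkRep_edge_cons (e e' : E) (β : List E) :
    sinkRep R G x₀ (.edge e) f (e' :: β) =
      if e' = e ∧ G.IsPath (G.rng e) β x₀ then f β else 0 := rfl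

open Classical in
theorem sinkRep_ghost_apply (e : E) (α : List E) :
    sinkRep R G x₀ (.ghost e) f α = if G.IsPath (G.rng e) α x₀ then f (e :: α) else 0 := rfl

theorem sinkRep_rel {x₀ : V} (hx₀ : G.IsSink x₀) (a b : FreeAssocAlg R (LeavittGen V E))
    (h : LeavittRel R G a b) : freeLift R (sinkRep R G x₀) a = freeLift R (sinkRep R G x₀) b := by
  classical
  induction h with
  | vert_idem x =>
    ext f α
    simp only [map_mul, freeLift_gen, Module.End.mul_apply, sinkRep_vert_apply]
    split_ifs <;> rfl
  | vert_orth x y h =>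
    ext f α
    simp only [map_mul, map_zero, freeLift_gen, Module.End.mul_apply, sinkRep_vert_apply]
    split_ifs with h₁ h₂
    · exact absurd (h₁.start_unique h₂) h
    all_goals rfl
  | src_edge e =>
    ext f α
    simp only [map_mul, freeLift_gen, Module.End.mul_apply, sinkRep_vert_apply]
    cases α with
    | nil => simp [sinkRep_edge_nil]
    | cons e' β =>
      simp only [sinkRep_edge_cons, DirGraph.IsPath]
      grind
  | edge_rng e =>
    ext f α
    simp only [map_mul, freeLift_gen, Module.End.mul_apply]
    cases α with
    | nil => simp [sinkRep_edge_nil]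
    | cons e' β =>
      simp only [sinkRep_edge_cons, sinkRep_vert_apply]
      grind
  | ghost_src e =>
    ext f α
    simp only [map_mul, freeLift_gen, Module.End.mul_apply, sinkRep_vert_apply,
      sinkRep_ghost_apply, DirGraph.IsPath]
    grind
  | rng_ghost e =>
    ext f α
    simp only [map_mul, freeLift_gen, Module.End.mul_apply, sinkRep_vert_apply,
      sinkRep_ghost_apply]
    grind
  | ghost_edge e =>
    ext f α
    simp only [map_mul, freeLift_gen, Module.End.mul_apply, sinkRep_vert_apply,
      sinkRep_ghost_apply, sinkRep_edge_cons]
    grind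
  | ghost_edge_ne e e' h =>
    ext f α
    simp only [map_mul, map_zero, freeLift_gen, Module.End.mul_apply,
      sinkRep_ghost_apply, sinkRep_edge_cons, h, false_and, if_false, ite_self]
    rfl
  | vert_sum x hne hfin =>
    ext f α
    simp only [map_sum, map_mul, freeLift_gen, LinearMap.sum_apply, Finset.sum_apply,
      Module.End.mul_apply, sinkRep_vert_apply]
    cases α with
    | nil =>
      -- a vertex that emits an edge is not the sink `x₀`, so the empty path does not start at it
      have hx : ¬ G.IsPath x [] x₀ := by
        rintro rfl
        obtain ⟨e, he⟩ := hne
        exact hx₀ e he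
      simp [sinkRep_edge_nil, hx]
    | cons e β =>
      simp only [sinkRep_edge_cons, sinkRep_ghost_apply, DirGraph.IsPath]
      by_cases he : G.src e = x
      · rw [Finset.sum_eq_single_of_mem e (by simpa using he) (by grind)]
        grind
      · rw [Finset.sum_eq_zero]
        · exact if_neg fun h => he h.1
        intro e' he'
        have : G.src e' = x := by simpa using he'
        grind

theorem vert_ne_zero_of_isSink [Nontrivial R] {x : V} (hx : G.IsSink x) : vert R G x ≠ 0 := by
  classical
  intro h
  have h₁ : sinkRep R G x (.vert x) = 0 := by
    rw [← lift_vert (G := G) (sinkRep R G x) (sinkRep_rel hx) x, h, map_zero]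
  have h₂ := congrFun (LinearMap.congr_fun h₁ 1) []
  simp [sinkRep_vert_apply, DirGraph.IsPath] at h₂

end Representation

/-! ### Monomials span -/

/-- The `R`-span of all monomials `α β*`. -/
def monomialSpan (R : Type w) [CommRing R] {V : Type u} {E : Type v} (G : DirGraph V E) :
    Submodule R (LeavittPathAlgebra R G) :=
  Submodule.span R {a | ∃ (x y z : V) (α β : List E), G.IsPath x α z ∧ G.IsPath y β z ∧
    a = path R G x α * ghostPath R G y β}

theorem monomial_mem {x y z : V} {α β : List E} (hα : G.IsPath x α z) (hβ : G.IsPath y β z) :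
    path R G x α * ghostPath R G y β ∈ monomialSpan R G :=
  Submodule.subset_span ⟨x, y, z, α, β, hα, hβ, rfl⟩

theorem gen_mem_monomialSpan (g : LeavittGen V E) :
    mk R G (FreeAssocAlg.gen R g) ∈ monomialSpan R G := by
  cases g with
  | vert x =>
    have := monomial_mem (R := R) (G := G) (x := x) (y := x) (z := x) (α := []) (β := []) rfl rfl
    rwa [path, ghostPath, vert_mul_self] at this
  | edge e =>
    have := monomial_mem (R := R) (G := G) (x := G.src e) (y := G.rng e) (z := G.rng e) (α := [e])
      (β := []) ⟨rfl, rfl⟩ rfl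
    rwa [path, path, ghostPath, edge_mul_vert, edge_mul_vert] at this
  | ghost e =>
    have := monomial_mem (R := R) (G := G) (x := G.rng e) (y := G.src e) (z := G.rng e) (α := [])
      (β := [e]) rfl ⟨rfl, rfl⟩
    rwa [path, ghostPath, ghostPath, vert_mul_ghost, vert_mul_ghost] at this

theorem monomial_mul_gen_mem {x y z : V} {α β : List E} (hα : G.IsPath x α z)
    (hβ : G.IsPath y β z) (g : LeavittGen V E) :
    path R G x α * ghostPath R G y β * mk R G (FreeAssocAlg.gen R g) ∈ monomialSpan R G := by
  cases g with
  | vert x' =>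
    change _ * vert R G x' ∈ _
    rw [← ghostPath_mul_vert hβ, mul_assoc, mul_assoc]
    by_cases h : y = x'
    · subst h
      rw [vert_mul_self, ghostPath_mul_vert hβ]
      exact monomial_mem hα hβ
    · rw [vert_mul_vert_of_ne h, mul_zero, mul_zero]
      exact zero_mem _
  | edge e =>
    change _ * edge R G e ∈ _
    cases β with
    | nil =>
      obtain rfl : y = z := hβ
      rw [ghostPath, path_mul_vert hα]
      by_cases h : y = G.src e
      · subst h
        have := monomial_mem (R := R) hα.append_edge (y := G.rng e) (β := []) rfl
        rwa [ghostPath, path_mul_vert hα.append_edge, path_append_edge hα] at this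
      · rw [← vert_mul_edge, ← path_mul_vert hα, mul_assoc, ← mul_assoc (vert R G y),
          vert_mul_vert_of_ne h, zero_mul, mul_zero]
        exact zero_mem _
    | cons f β =>
      rw [ghostPath, mul_assoc, mul_assoc]
      by_cases h : f = e
      · subst h
        rw [ghost_mul_edge, ghostPath_mul_vert hβ.2]
        exact monomial_mem hα hβ.2
      · rw [ghost_mul_edge_of_ne h, mul_zero, mul_zero]
        exact zero_mem _
  | ghost e =>
    change _ * ghost R G e ∈ _
    by_cases h : y = G.rng e
    · subst h
      rw [mul_assoc]
      exact monomial_mem (y := G.src e) (β := e :: β) hα ⟨rfl, hβ⟩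
    · rw [← vert_mul_ghost, ← ghostPath_mul_vert hβ, mul_assoc, mul_assoc,
        ← mul_assoc (vert R G y), vert_mul_vert_of_ne h, zero_mul, mul_zero, mul_zero]
      exact zero_mem _

theorem mul_gen_mem {a : LeavittPathAlgebra R G} (ha : a ∈ monomialSpan R G)
    (g : LeavittGen V E) : a * mk R G (FreeAssocAlg.gen R g) ∈ monomialSpan R G := by
  induction ha using Submodule.span_induction with
  | mem a h =>
    obtain ⟨x, y, z, α, β, hα, hβ, rfl⟩ := h
    exact monomial_mul_gen_mem hα hβ g
  | zero => rw [zero_mul]; exact zero_mem _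
  | add a b _ _ iha ihb => rw [add_mul]; exact add_mem iha ihb
  | smul c a _ ih => rw [smul_mul_assoc]; exact Submodule.smul_mem _ c ih

theorem mul_word_mem (w : FreeSemigroup (LeavittGen V E)) :
    ∀ a ∈ monomialSpan R G, a * mk R G (MonoidAlgebra.single w 1) ∈ monomialSpan R G := by
  induction w using FreeSemigroup.recOnMul with
  | ih1 g => exact fun a ha => mul_gen_mem ha g
  | ih2 g w h₁ h₂ =>
    intro a ha
    have : (MonoidAlgebra.single (FreeSemigroup.of g * w) 1 : FreeAssocAlg R (LeavittGen V E)) =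
        MonoidAlgebra.single (FreeSemigroup.of g) 1 * MonoidAlgebra.single w 1 := by
      rw [MonoidAlgebra.single_mul_single, one_mul]
    rw [this, map_mul, ← mul_assoc]
    exact h₂ _ (h₁ _ ha)

theorem word_mem (w : FreeSemigroup (LeavittGen V E)) :
    mk R G (MonoidAlgebra.single w 1) ∈ monomialSpan R G := by
  induction w using FreeSemigroup.recOnMul with
  | ih1 g => exact gen_mem_monomialSpan g
  | ih2 g w h₁ h₂ =>
    have : (MonoidAlgebra.single (FreeSemigroup.of g * w) 1 : FreeAssocAlg R (LeavittGen V E)) =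
        MonoidAlgebra.single (FreeSemigroup.of g) 1 * MonoidAlgebra.single w 1 := by
      rw [MonoidAlgebra.single_mul_single, one_mul]
    rw [this, map_mul]
    exact mul_word_mem w _ h₁

theorem monomialSpan_eq_top : monomialSpan R G = ⊤ := by
  refine (Submodule.eq_top_iff').2 fun a => ?_
  obtain ⟨a, rfl⟩ := mk_surjective R G a
  induction a using MonoidAlgebra.induction_linear with
  | zero => rw [map_zero]; exact zero_mem _
  | add a b iha ihb => rw [map_add]; exact add_mem iha ihb
  | single w c =>
    have : (MonoidAlgebra.single w c : FreeAssocAlg R (LeavittGen V E)) =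
        c • MonoidAlgebra.single w 1 := by simp
    rw [this, mk_smul]
    exact Submodule.smul_mem _ c (word_mem w)

/-! ### Gradings induced by a homomorphism from the integers -/

section Grading

variable {Γ : Type u₁} [AddCommGroup Γ] (d : ℤ →+ Γ)

/-- The `Γ`-grading of `L_R(G)` obtained from the canonical `ℤ`-grading by pushing degrees forward
along `d : ℤ →+ Γ`. -/
def pushGrading (R : Type w) [CommRing R] {V : Type u} {E : Type v} (G : DirGraph V E)
    (d : ℤ →+ Γ) (γ : Γ) : AddSubgroup (LeavittPathAlgebra R G) :=
  ⨆ (m : ℤ) (_ : d m = γ), grading R G m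

theorem pushGrading_id : pushGrading R G (AddMonoidHom.id ℤ) = grading R G := by
  ext1 m
  exact iSup_iSup_eq_left

theorem pushGrading_castAddHom (n : ℕ) :
    pushGrading R G (Int.castAddHom (ZMod n)) = modGrading R G n := rfl

theorem monomial_mem_pushGrading {x y z : V} {α β : List E} (hα : G.IsPath x α z)
    (hβ : G.IsPath y β z) {γ : Γ} (h : d ((α.length : ℤ) - (β.length : ℤ)) = γ) :
    path R G x α * ghostPath R G y β ∈ pushGrading R G d γ :=
  AddSubgroup.mem_iSup_of_mem _ (AddSubgroup.mem_iSup_of_mem h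
    (Submodule.subset_span ⟨x, y, z, α, β, hα, hβ, rfl, rfl⟩))

/-- To check an `R`-linear condition on a homogeneous component it suffices to look at the
monomials in it. -/
theorem pushGrading_le {γ : Γ} (M : Submodule R (LeavittPathAlgebra R G))
    (h : ∀ (x y z : V) (α β : List E), G.IsPath x α z → G.IsPath y β z →
      d ((α.length : ℤ) - (β.length : ℤ)) = γ → path R G x α * ghostPath R G y β ∈ M) :
    pushGrading R G d γ ≤ M.toAddSubgroup := by
  refine iSup₂_le fun m hm => ?_
  have : component R G m ≤ M := by
    refine Submodule.span_le.2 ?_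
    rintro _ ⟨x, y, z, α, β, hα, hβ, rfl, rfl⟩
    exact h x y z α β hα hβ hm
  exact this

theorem vert_mem_pushGrading (x : V) : vert R G x ∈ pushGrading R G d 0 := by
  have := monomial_mem_pushGrading (R := R) (G := G) d (x := x) (y := x) (z := x) (α := [])
    (β := []) (γ := 0) rfl rfl (by simp)
  rwa [path, ghostPath, vert_mul_self] at this

theorem smul_mem_pushGrading (c : R) {γ : Γ} {a : LeavittPathAlgebra R G}
    (ha : a ∈ pushGrading R G d γ) : c • a ∈ pushGrading R G d γ := by
  have h : pushGrading R G d γ ≤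
      (pushGrading R G d γ).comap (DistribSMul.toAddMonoidHom (LeavittPathAlgebra R G) c) :=
    iSup₂_le fun m hm b hb => AddSubgroup.mem_iSup_of_mem m
      (AddSubgroup.mem_iSup_of_mem hm ((component R G m).smul_mem c hb))
  exact h ha

theorem iSup_pushGrading : ⨆ γ, pushGrading R G d γ = ⊤ := by
  refine (AddSubgroup.eq_top_iff' _).2 fun a => ?_
  have ha : a ∈ monomialSpan R G := by rw [monomialSpan_eq_top]; trivial
  induction ha using Submodule.span_induction with
  | mem a h =>
    obtain ⟨x, y, z, α, β, hα, hβ, rfl⟩ := h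
    exact AddSubgroup.mem_iSup_of_mem _ (monomial_mem_pushGrading d hα hβ rfl)
  | zero => exact zero_mem _
  | add a b _ _ iha ihb => exact add_mem iha ihb
  | smul c a _ ih =>
    have h : (⨆ γ, pushGrading R G d γ) ≤ (⨆ γ, pushGrading R G d γ).comap
        (DistribSMul.toAddMonoidHom (LeavittPathAlgebra R G) c) :=
      iSup_le fun γ b hb => AddSubgroup.mem_iSup_of_mem γ (smul_mem_pushGrading d c hb)
    exact h ih

/-- The values of `degreeHom` on the generators. -/
def degreeGen (R : Type w) [CommRing R] {V : Type u} {E : Type v} (G : DirGraph V E)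
    (d : ℤ →+ Γ) : LeavittGen V E → AddMonoidAlgebra (Unitization R (LeavittPathAlgebra R G)) Γ
  | .vert x => .single 0 (vert R G x)
  | .edge e => .single (d 1) (edge R G e)
  | .ghost e => .single (-d 1) (ghost R G e)

theorem degreeGen_rel (a b : FreeAssocAlg R (LeavittGen V E)) (h : LeavittRel R G a b) :
    freeLift R (degreeGen R G d) a = freeLift R (degreeGen R G d) b := by
  induction h with
  | vert_sum x hne hfin =>
    simp only [map_mul, map_sum, freeLift_gen, degreeGen, AddMonoidAlgebra.single_mul_single,
      ← Unitization.inr_mul, add_neg_cancel]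
    rw [vert_eq_sum x hne hfin, ← Unitization.inrHom_apply R R, map_sum]
    exact map_sum (AddMonoidAlgebra.singleAddHom _) _ _
  | vert_orth x y h =>
    simp [degreeGen, AddMonoidAlgebra.single_mul_single, ← Unitization.inr_mul,
      vert_mul_vert_of_ne h]
  | ghost_edge_ne e f h =>
    simp [degreeGen, AddMonoidAlgebra.single_mul_single, ← Unitization.inr_mul,
      ghost_mul_edge_of_ne h]
  | _ =>
    simp [degreeGen, AddMonoidAlgebra.single_mul_single, ← Unitization.inr_mul,
      vert_mul_self, vert_mul_edge, edge_mul_vert, ghost_mul_vert, vert_mul_ghost, ghost_mul_edge]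

/-- The homomorphism to the group algebra of `Γ` that records degrees: an element `a` of degree `γ`
is sent to `a t^γ`. The coefficients are taken in the unitization of `L_R(G)` because the group
algebra needs a unital coefficient ring. -/
def degreeHom (R : Type w) [CommRing R] {V : Type u} {E : Type v} (G : DirGraph V E)
    (d : ℤ →+ Γ) :
    LeavittPathAlgebra R G →ₙₐ[R] AddMonoidAlgebra (Unitization R (LeavittPathAlgebra R G)) Γ :=
  lift (degreeGen R G d) (degreeGen_rel d)

theorem degreeHom_path (x : V) (α : List E) :
    degreeHom R G d (path R G x α) = .single (d α.length) (path R G x α) := by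
  induction α generalizing x with
  | nil => simp [path, degreeHom, degreeGen]
  | cons e α ih =>
    rw [path, map_mul, ih, degreeHom, lift_edge, degreeGen, AddMonoidAlgebra.single_mul_single,
      ← Unitization.inr_mul, ← map_add]
    congr 2
    push_cast [List.length_cons]
    ring

theorem degreeHom_ghostPath (x : V) (α : List E) :
    degreeHom R G d (ghostPath R G x α) = .single (d (-α.length)) (ghostPath R G x α) := by
  induction α generalizing x with
  | nil => simp [ghostPath, degreeHom, degreeGen]
  | cons e α ih =>
    rw [ghostPath, map_mul, ih, degreeHom, lift_ghost, degreeGen,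
      AddMonoidAlgebra.single_mul_single, ← Unitization.inr_mul, ← map_neg, ← map_add]
    congr 2
    push_cast [List.length_cons]
    ring

theorem degreeHom_of_mem {γ : Γ} {a : LeavittPathAlgebra R G} (ha : a ∈ pushGrading R G d γ) :
    degreeHom R G d a = .single γ (a : Unitization R (LeavittPathAlgebra R G)) := by
  refine pushGrading_le d
    { carrier := {a | degreeHom R G d a = .single γ (a : Unitization R (LeavittPathAlgebra R G))}
      add_mem' := fun {a b} ha hb => ?_
      zero_mem' := ?_
      smul_mem' := fun c a ha => ?_ } ?_ ha
  · change _ = _ at ha hb ⊢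
    rw [map_add, ha, hb, Unitization.inr_add, AddMonoidAlgebra.single_add]
  · simp
  · change _ = _ at ha ⊢
    rw [map_smul, ha, Unitization.inr_smul, AddMonoidAlgebra.smul_single]
  · rintro x y z α β - - rfl
    change _ = _
    rw [map_mul, degreeHom_path, degreeHom_ghostPath, AddMonoidAlgebra.single_mul_single,
      ← map_add, ← Unitization.inr_mul, sub_eq_add_neg]

theorem coeff_degreeHom [DecidableEq Γ] (f : DirectSum Γ fun γ => pushGrading R G d γ) (γ : Γ) :
    (degreeHom R G d (DirectSum.coeAddMonoidHom _ f)).coeff γ =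
      ((f γ : LeavittPathAlgebra R G) : Unitization R (LeavittPathAlgebra R G)) := by
  induction f using DirectSum.induction_on with
  | zero => simp
  | of δ a =>
    rw [DirectSum.coeAddMonoidHom_of, degreeHom_of_mem d a.2, AddMonoidAlgebra.coeff_single]
    by_cases h : δ = γ
    · subst h
      rw [Finsupp.single_eq_same, DirectSum.of_eq_same]
    · rw [Finsupp.single_eq_of_ne (Ne.symm h), DirectSum.of_eq_of_ne _ _ _ (Ne.symm h)]
      simp
  | add f g hf hg =>
    rw [map_add, map_add, AddMonoidAlgebra.coeff_add, Finsupp.add_apply, hf, hg,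
      DirectSum.add_apply, AddSubgroup.coe_add, Unitization.inr_add]

theorem isInternal_pushGrading [DecidableEq Γ] : DirectSum.IsInternal (pushGrading R G d) := by
  constructor
  · refine (injective_iff_map_eq_zero _).2 fun f hf => ?_
    ext γ
    have := coeff_degreeHom d f γ
    rw [hf, map_zero, AddMonoidAlgebra.coeff_zero, Finsupp.zero_apply] at this
    exact Unitization.inr_injective (R := R) this.symm
  · rw [← AddMonoidHom.range_eq_top, eq_top_iff, ← iSup_pushGrading d]
    exact iSup_le fun γ a ha => ⟨DirectSum.of _ γ ⟨a, ha⟩, DirectSum.coeAddMonoidHom_of _ _ _⟩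

theorem mem_pushGrading_iff {γ : Γ} {a : LeavittPathAlgebra R G} :
    a ∈ pushGrading R G d γ ↔
      degreeHom R G d a = .single γ (a : Unitization R (LeavittPathAlgebra R G)) := by
  classical
  refine ⟨degreeHom_of_mem d, fun h => ?_⟩
  obtain ⟨f, rfl⟩ := (isInternal_pushGrading d).2 a
  have := coeff_degreeHom d f γ
  rw [h, AddMonoidAlgebra.coeff_single, Finsupp.single_eq_same, Unitization.inr_inj] at this
  rw [this]
  exact (f γ).2

theorem mul_mem_pushGrading {γ δ : Γ} {a b : LeavittPathAlgebra R G}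
    (ha : a ∈ pushGrading R G d γ) (hb : b ∈ pushGrading R G d δ) :
    a * b ∈ pushGrading R G d (γ + δ) := by
  rw [mem_pushGrading_iff] at *
  rw [map_mul, ha, hb, AddMonoidAlgebra.single_mul_single, Unitization.inr_mul]

/-! ### Strong gradings and vertices -/

/-- The additive subgroup generated by the products of elements of degrees `γ` and `δ`. -/
def mulClosure (R : Type w) [CommRing R] {V : Type u} {E : Type v} (G : DirGraph V E)
    (d : ℤ →+ Γ) (γ δ : Γ) : AddSubgroup (LeavittPathAlgebra R G) :=
  AddSubgroup.closure {c | ∃ a ∈ pushGrading R G d γ, ∃ b ∈ pushGrading R G d δ, c = a * b}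

theorem mul_mem_mulClosure {γ δ : Γ} {a b : LeavittPathAlgebra R G}
    (ha : a ∈ pushGrading R G d γ) (hb : b ∈ pushGrading R G d δ) :
    a * b ∈ mulClosure R G d γ δ :=
  AddSubgroup.subset_closure ⟨a, ha, b, hb, rfl⟩

theorem mulClosure_mul_mem {γ δ ε : Γ} {a b : LeavittPathAlgebra R G}
    (ha : a ∈ mulClosure R G d γ δ) (hb : b ∈ pushGrading R G d ε) :
    a * b ∈ mulClosure R G d γ (δ + ε) := by
  induction ha using AddSubgroup.closure_induction with
  | mem c h =>
    obtain ⟨a₁, h₁, a₂, h₂, rfl⟩ := h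
    rw [mul_assoc]
    exact mul_mem_mulClosure d h₁ (mul_mem_pushGrading d h₂ hb)
  | zero => rw [zero_mul]; exact zero_mem _
  | add a₁ a₂ _ _ h₁ h₂ => rw [add_mul]; exact add_mem h₁ h₂
  | neg a _ h => rw [neg_mul]; exact neg_mem h

theorem smul_mem_mulClosure (c : R) {γ δ : Γ} {a : LeavittPathAlgebra R G}
    (ha : a ∈ mulClosure R G d γ δ) : c • a ∈ mulClosure R G d γ δ := by
  induction ha using AddSubgroup.closure_induction with
  | mem b h =>
    obtain ⟨a₁, h₁, a₂, h₂, rfl⟩ := h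
    rw [← smul_mul_assoc]
    exact mul_mem_mulClosure d (smul_mem_pushGrading d c h₁) h₂
  | zero => rw [smul_zero]; exact zero_mem _
  | add a₁ a₂ _ _ h₁ h₂ => rw [smul_add]; exact add_mem h₁ h₂
  | neg a _ h => rw [smul_neg]; exact neg_mem h

theorem isStronglyGraded_of_vert_mem [DecidableEq Γ]
    (h : ∀ (x : V) (γ : Γ), vert R G x ∈ mulClosure R G d γ (-γ)) :
    IsStronglyGraded (pushGrading R G d) := by
  refine ⟨isInternal_pushGrading d, fun γ δ => le_antisymm ?_ ?_⟩
  · refine (AddSubgroup.closure_le _).2 ?_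
    rintro _ ⟨a, ha, b, hb, rfl⟩
    exact mul_mem_pushGrading d ha hb
  · refine pushGrading_le d
      { mulClosure R G d γ δ with smul_mem' := fun c _ ha => smul_mem_mulClosure d c ha } ?_
    intro x y z α β hα hβ hd
    have := mulClosure_mul_mem d (h x γ) (monomial_mem_pushGrading (R := R) d hα hβ hd)
    rwa [neg_add_cancel_left, ← mul_assoc, vert_mul_path hα] at this

/-- If no path from `x` of length less than `N` ends at a sink, then `x` is the sum of the `α α*`
over the paths `α` of length `N` starting at `x`. Only the consequence that `x` lies in the additive
subgroup generated by these `α α*` is recorded. -/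
theorem vert_mem_closure_paths (hG : G.RowFinite) (N : ℕ) (x : V)
    (h : ∀ (α : List E) (z : V), G.IsPath x α z → α.length < N → ¬ G.IsSink z) :
    vert R G x ∈ AddSubgroup.closure {a | ∃ (α : List E) (z : V), G.IsPath x α z ∧
      α.length = N ∧ a = path R G x α * ghostPath R G x α} := by
  induction N generalizing x with
  | zero =>
    refine AddSubgroup.subset_closure ⟨[], x, rfl, rfl, ?_⟩
    rw [path, ghostPath, vert_mul_self]
  | succ N ih =>
    have hx : ¬ G.IsSink x := h [] x rfl N.succ_pos
    have hne : {e : E | G.src e = x}.Nonempty := by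
      simpa [DirGraph.IsSink, Set.Nonempty] using hx
    rw [vert_eq_sum x hne (hG x)]
    refine sum_mem fun e he => ?_
    obtain rfl : G.src e = x := by simpa using he
    have he' := ih (G.rng e) fun α z hα hN =>
      h (e :: α) z ⟨rfl, hα⟩ (by simpa using hN)
    rw [← edge_mul_vert]
    generalize vert R G (G.rng e) = a at he'
    induction he' using AddSubgroup.closure_induction with
    | mem a ha =>
      obtain ⟨α, z, hα, rfl, rfl⟩ := ha
      refine AddSubgroup.subset_closure ⟨e :: α, z, ⟨rfl, hα⟩, rfl, ?_⟩
      simp only [path, ghostPath, mul_assoc]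
    | zero => rw [mul_zero, zero_mul]; exact zero_mem _
    | add a b _ _ ha hb => rw [mul_add, add_mul]; exact add_mem ha hb
    | neg a _ ha => rw [mul_neg, neg_mul]; exact neg_mem ha

/-- A combinatorial criterion for strong grading: for each vertex `x` and each degree `γ` there is
a length `N` such that the paths `α` of length `N` starting at `x` exhaust `x`, and each of them
has a companion `β` with the same range for which `α β*` has degree `γ`. -/
theorem isStronglyGraded_of_paths [DecidableEq Γ] (hG : G.RowFinite)
    (h : ∀ (x : V) (γ : Γ), ∃ N : ℕ,
      (∀ (α : List E) (z : V), G.IsPath x α z → α.length < N → ¬ G.IsSink z) ∧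
      ∀ (α : List E) (z : V), G.IsPath x α z → α.length = N →
        ∃ (y : V) (β : List E), G.IsPath y β z ∧ d ((N : ℤ) - (β.length : ℤ)) = γ) :
    IsStronglyGraded (pushGrading R G d) := by
  refine isStronglyGraded_of_vert_mem d fun x γ => ?_
  obtain ⟨N, h₁, h₂⟩ := h x γ
  refine (AddSubgroup.closure_le _).2 ?_ (vert_mem_closure_paths hG N x h₁)
  rintro _ ⟨α, z, hα, rfl, rfl⟩
  obtain ⟨y, β, hβ, hγ⟩ := h₂ α z hα rfl
  have : path R G x α * ghostPath R G x α =
      path R G x α * ghostPath R G y β * (path R G y β * ghostPath R G x α) := by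
    rw [mul_assoc, ← mul_assoc (ghostPath R G y β), ghostPath_mul_path hβ, vert_mul_ghostPath hα]
  rw [this]
  refine mul_mem_mulClosure d (monomial_mem_pushGrading d hα hβ hγ)
    (monomial_mem_pushGrading d hβ hα ?_)
  rw [← hγ, ← map_neg, neg_sub]

theorem not_isStronglyGraded_of_isSink [Nontrivial R] [DecidableEq Γ] {x : V} (hx : G.IsSink x)
    (γ : Γ) (h : ∀ (y : V) (β : List E), G.IsPath y β x → d (-(β.length : ℤ)) ≠ γ) :
    ¬ IsStronglyGraded (pushGrading R G d) := by
  intro hs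
  have hann : ∀ a ∈ pushGrading R G d γ, vert R G x * a = 0 := by
    intro a ha
    refine pushGrading_le d (LinearMap.ker (LinearMap.mulLeft R (vert R G x))) ?_ ha
    intro x' y z α β hα hβ hd
    rw [LinearMap.mem_ker, LinearMap.mulLeft_apply, ← vert_mul_path hα, ← mul_assoc, ← mul_assoc]
    by_cases hxx : x = x'
    · subst hxx
      -- the only path that starts at the sink `x` is the empty one
      obtain rfl := hα.eq_nil_of_isSink hx
      obtain rfl : x = z := hα
      exact absurd (by simpa using hd) (h y β hβ)
    · rw [vert_mul_vert_of_ne hxx, zero_mul, zero_mul]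
  have hmem : vert R G x ∈ mulClosure R G d γ (-γ) := by
    rw [mulClosure, hs.mul_eq, add_neg_cancel]
    exact vert_mem_pushGrading d x
  have hle : mulClosure R G d γ (-γ) ≤ (AddMonoidHom.mulLeft (vert R G x)).ker := by
    refine (AddSubgroup.closure_le _).2 ?_
    rintro _ ⟨a, ha, b, -, rfl⟩
    change vert R G x * (a * b) = 0
    rw [← mul_assoc, hann a ha, zero_mul]
  exact vert_ne_zero_of_isSink hx ((vert_mul_self x).symm.trans (hle hmem))

end Grading

/-! ### Gradings by the integers and by residues -/

theorem isStronglyGraded_modGrading_two_iff [Nontrivial R] (hG : G.RowFinite) :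
    IsStronglyGraded (modGrading R G 2) ↔ ∀ x : V, ¬ G.IsIsolated x := by
  rw [← pushGrading_castAddHom]
  constructor
  · intro hs x hx
    refine not_isStronglyGraded_of_isSink _ (fun e => (hx e).1) 1 (fun y β hβ => ?_) hs
    obtain rfl := hβ.eq_nil_of_isIsolated hx
    simp
  · refine fun h => isStronglyGraded_of_paths _ hG fun x γ => ?_
    have hγ : γ = 0 ∨ γ = 1 := by revert γ; decide
    obtain rfl | rfl := hγ
    · exact ⟨0, by simp, fun α z _ _ => ⟨z, [], rfl, by simp⟩⟩
    · by_cases hx : G.IsSink x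
      · obtain ⟨e, rfl⟩ : ∃ e, G.rng e = x := by
          by_contra! he
          exact h x fun e => ⟨hx e, he e⟩
        refine ⟨0, by simp, fun α z hα hN => ⟨G.src e, [e], ?_, by simp⟩⟩
        obtain rfl := List.eq_nil_of_length_eq_zero hN
        exact ⟨rfl, hα⟩
      · refine ⟨1, fun α z hα hN => ?_, fun α z _ _ => ⟨z, [], rfl, by simp⟩⟩
        obtain rfl := List.eq_nil_of_length_eq_zero (Nat.lt_one_iff.1 hN)
        obtain rfl : x = z := hα
        exact hx

theorem isStronglyGraded_modGrading (hG : G.RowFinite) (h : ∀ x : V, ¬ G.IsSink x) {n : ℕ}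
    (hn : 1 ≤ n) : IsStronglyGraded (modGrading R G n) := by
  rw [← pushGrading_castAddHom]
  refine isStronglyGraded_of_paths _ hG fun x γ =>
    ⟨γ.val, fun _ z _ _ => h z, fun α z _ _ => ⟨z, [], rfl, ?_⟩⟩
  have : NeZero n := ⟨by omega⟩
  simp

theorem isStronglyGraded_grading_of_finite [Finite V] (hG : G.RowFinite)
    (h : ∀ x : V, ¬ G.IsSink x) : IsStronglyGraded (grading R G) := by
  rw [← pushGrading_id]
  obtain ⟨n, hn⟩ := WellFoundedGT.monotone_chain_condition
    (⟨fun k => OrderDual.toDual (G.pathEnds k), G.pathEnds_antitone⟩ : ℕ →o (Set V)ᵒᵈ)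
  replace hn : ∀ m, n ≤ m → G.pathEnds n = G.pathEnds m := hn
  refine isStronglyGraded_of_paths _ hG fun x γ =>
    ⟨n + γ.natAbs, fun _ z _ _ => h z, fun α z hα hN => ?_⟩
  have hz : z ∈ G.pathEnds (n + γ.natAbs) := ⟨x, α, hα, hN⟩
  -- `|α|` exceeds `n` by `|γ|`, so the length `|α| - γ` wanted for `β` is still at least `n`
  rw [← hn _ (by omega), hn ((n + γ.natAbs : ℤ) - γ).toNat (by omega)] at hz
  obtain ⟨y, β, hβ, hlen⟩ := hz
  refine ⟨y, β, hβ, ?_⟩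
  rw [hlen, AddMonoidHom.id_apply]
  omega

theorem not_isSink_of_isStronglyGraded_grading [Nontrivial R]
    (hs : IsStronglyGraded (grading R G)) (x : V) : ¬ G.IsSink x := by
  rw [← pushGrading_id] at hs
  refine fun hx => not_isStronglyGraded_of_isSink _ hx 1 (fun y β _ => ?_) hs
  rw [AddMonoidHom.id_apply]
  omega

end LeavittPathAlgebra

end

theorem corollary4p4 {R : Type w} [CommRing R] [Nontrivial R] {V : Type u} {E : Type v}
    (G : DirGraph V E) (hG : G.RowFinite) :
    (IsStronglyGraded (LeavittPathAlgebra.modGrading R G 2) ↔ ∀ x : V, ¬ G.IsIsolated x) ∧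
    ((∀ x : V, ¬ G.IsSink x) →
      ∀ n : ℕ, 1 ≤ n → IsStronglyGraded (LeavittPathAlgebra.modGrading R G n)) ∧
    (Finite V →
      (IsStronglyGraded (LeavittPathAlgebra.grading R G) ↔ ∀ x : V, ¬ G.IsSink x)) := by
  refine ⟨LeavittPathAlgebra.isStronglyGraded_modGrading_two_iff hG,
    fun h n hn => LeavittPathAlgebra.isStronglyGraded_modGrading hG h hn, fun _ => ⟨?_, ?_⟩⟩
  · exact fun hs x => LeavittPathAlgebra.not_isSink_of_isStronglyGraded_grading hs x
  · exact LeavittPathAlgebra.isStronglyGraded_grading_of_finite hG
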